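/- For a positive integer $n$, a graph $H$ and, for each vertex $v$ of the complete graph $K_n$, a (not necessarily proper) colouring $f_v$ of the edges of $K_n$, the collection $(f_v)_{v\in V(K_n)}$ is called $(n,H)$-local if for every copy $T$ of $H$ in $K_n$ (a not necessarily induced subgraph isomorphic to $H$) there is some $u\in V(T)$ such that all edges of $T$ receive different colours in $f_u$. Let $g(n,H)$ be the smallest $k$ for which there is an $(n,H)$-local collection of colourings of $E(K_n)$, each using colours from a palette of $k$ colours. Theorem. For every integer $\ell\ge 2$ we have $g(n,C_{2\ell})=\Omega\left(n^{1-\frac{2}{\ell+1}}\right)$ as $n\to\infty$, where the implied constant depends only on $\ell$. Consequently, for every even $r\ge 4$, $g(n,K_r)=\Omega\left(n^{1-\frac{4}{r+2}}\right)$ as $n\to\infty$, where the implied constant depends only on $r$. In particular, for every $\varepsilon>0$ there is some $r=r(\varepsilon)$ such that $g(n,K_r)\ge n^{1-\varepsilon}$ for all sufficiently large $n$. -/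

import Mathlib

/-- A collection `f` of edge-colourings of the complete graph on `Fin n` (one colouring `f v` for
each vertex `v`) is `(n, H)`-local if every copy `T` of `H` in `K_n` has a vertex `u` such that all
edges of `T` receive different colours in `f u`. A copy of `H` is a (not necessarily induced)
subgraph of `K_n` isomorphic to `H`. -/
def IsLocalColouring {V : Type*} (H : SimpleGraph V) {n : ℕ} {K : Type*}
    (f : Fin n → (SimpleGraph.completeGraph (Fin n)).edgeSet → K) : Prop :=
  ∀ T : (SimpleGraph.completeGraph (Fin n)).Subgraph, Nonempty (H ≃g T.coe) →
    ∃ u ∈ T.verts,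
      Set.InjOn (f u) {e : (SimpleGraph.completeGraph (Fin n)).edgeSet | (e : Sym2 (Fin n)) ∈ T.edgeSet}

/-- `localColourNumber n H` is `g(n, H)`: the smallest `k` for which there is an `(n, H)`-local
collection of colourings of the edges of `K_n` with palette `Fin k`. -/
noncomputable def localColourNumber (n : ℕ) {V : Type*} (H : SimpleGraph V) : ℕ :=
  sInf {k : ℕ | ∃ f : Fin n → (SimpleGraph.completeGraph (Fin n)).edgeSet → Fin k, IsLocalColouring H f}

/-- If `H` has a vertex, the minimum defining `g(n, H)` is over a nonempty set, hence attained. -/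
theorem localColourNumber_isLeast (n : ℕ) {V : Type*} [Nonempty V] (H : SimpleGraph V) :
    IsLeast {k : ℕ | ∃ f : Fin n → (SimpleGraph.completeGraph (Fin n)).edgeSet → Fin k,
        IsLocalColouring H f}
      (localColourNumber n H) := by
  classical
  refine ⟨Nat.sInf_mem ⟨Fintype.card (SimpleGraph.completeGraph (Fin n)).edgeSet,
    fun _ => Fintype.equivFin _, ?_⟩, fun k hk => Nat.sInf_le hk⟩
  rintro T ⟨i⟩
  obtain ⟨v⟩ := ‹Nonempty V›
  exact ⟨i v, (i v).2, fun a _ b _ h => (Fintype.equivFin _).injective h⟩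

/-!
The colourings `f u` are turned into one graph `Γ` on the nodes `(u, i)`, `u` a vertex and `i` a
colour: each edge `uv` of `K_n` becomes an edge between `(u, f u (uv))` and `(v, f v (uv))`. A cycle
of length `2ℓ` in `Γ` whose nodes have pairwise distinct first coordinates is a `2ℓ`-cycle in `K_n`
each of whose vertices sees its own two incident edges in the same colour. Such a cycle, and every
graph on its vertices containing it, witnesses that the collection is not local. It remains to find
it: `Γ` has `n k` nodes and about `n² / 2` edges, so the Bondy–Simonovits threshold
`(n k) ^ (1 + 1 / ℓ)` for the number of edges is passed once `k` is a small multiple of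
`n ^ ((ℓ - 1) / (ℓ + 1))`. The requirement of distinct first coordinates is met because a node has
at most one neighbour with a given first coordinate.

Closed walks are counted with the weights `W x y = 1 / √(deg x * deg y)` on the edges of `Γ` whose
ends both have degree at least `δ = (n - 1) / (4 k)`. Let `m i` be the trace of `W ^ (2 i)`.
* The Rayleigh quotient of `W` at `x ↦ √(deg x)` is at least `1 / 2`, whence `m ℓ ≥ 4 ^ (-ℓ)`
  (`le_evenMoment`, `le_rayleigh_colourMatrix`).
* By Cauchy–Schwarz, the closed walks of length `2ℓ` whose nodes at two given times share their
  first coordinate have total weight at most `√(η * m (ℓ - 1) * m ℓ)`, where `η = 1 / δ` bounds the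
  sums of squares of the rows of `W` (`sq_degenerateWeight_le`).
* If all closed walks of length `2ℓ` are of this kind, a union bound over the pairs of times gives
  `m ℓ ≤ 16 ℓ ^ 4 η * m (ℓ - 1)`. As `m` is log-convex and `m 0` is the number of nodes, it follows
  that `m ℓ ≤ (16 ℓ ^ 4 η) ^ ℓ * n k` (`exists_nondegenerate_closed_walk`).

Comparing the two bounds gives `n ^ (ℓ - 1) ≤ (512 ℓ ^ 4) ^ ℓ * k ^ (ℓ + 1)` for every local
collection. For `K_r` with `r = 2ℓ` the same cycle is used, as a spanning subgraph.
-/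

/-! ### Weighted sums over walks -/

section WalkSum

variable {X : Type*} [Fintype X]

/-- The sum of `F s` over all walks `s` with `m` steps starting at `x`, each weighted by the product
of the entries of `W` along its steps. A walk is encoded as a sequence `ℕ → X` that is constant from
time `m` on, which avoids casts between walks of different lengths. -/
def walkSum (W : Matrix X X ℝ) : ℕ → X → ((ℕ → X) → ℝ) → ℝ
  | 0, x, F => F (fun _ => x)
  | m + 1, x, F => ∑ y, W x y * walkSum W m y (fun s => F (fun t => Nat.casesOn t x s))

theorem walkSum_mono {W : Matrix X X ℝ} (hW : ∀ x y, 0 ≤ W x y) (m : ℕ) (x : X)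
    {F G : (ℕ → X) → ℝ}
    (h : ∀ s : ℕ → X, s 0 = x → (∀ i < m, W (s i) (s (i + 1)) ≠ 0) → F s ≤ G s) :
    walkSum W m x F ≤ walkSum W m x G := by
  induction m generalizing x F G with
  | zero => exact h _ rfl (by simp)
  | succ m ih =>
    refine Finset.sum_le_sum fun y _ => ?_
    by_cases hxy : W x y = 0
    · simp [hxy]
    refine mul_le_mul_of_nonneg_left (ih y fun s hs hs' => h _ rfl ?_) (hW x y)
    rintro (_ | i) hi
    · simpa [hs] using hxy
    · exact hs' i (by omega)

theorem walkSum_congr {W : Matrix X X ℝ} (hW : ∀ x y, 0 ≤ W x y) (m : ℕ) (x : X)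
    {F G : (ℕ → X) → ℝ} (h : ∀ s : ℕ → X, s 0 = x → F s = G s) :
    walkSum W m x F = walkSum W m x G :=
  le_antisymm (walkSum_mono hW m x fun s hs _ => (h s hs).le)
    (walkSum_mono hW m x fun s hs _ => (h s hs).ge)

theorem walkSum_sum (W : Matrix X X ℝ) {ι : Type*} (S : Finset ι) (m : ℕ) (x : X)
    (F : ι → (ℕ → X) → ℝ) :
    walkSum W m x (fun s => ∑ i ∈ S, F i s) = ∑ i ∈ S, walkSum W m x (F i) := by
  induction m generalizing x F with
  | zero => rfl
  | succ m ih =>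
    simp only [walkSum, ih, Finset.mul_sum]
    exact Finset.sum_comm

/-- A functional of the walk after time `i` only sees where the walk is at time `i`, with the
entries of `W ^ i` as weights. -/
theorem walkSum_shift [DecidableEq X] (W : Matrix X X ℝ) (m i : ℕ) (x : X)
    (G : (ℕ → X) → ℝ) :
    walkSum W (m + i) x (fun s => G fun t => s (t + i)) = ∑ z, (W ^ i) x z * walkSum W m z G := by
  induction i generalizing x with
  | zero => simp [Matrix.one_apply]
  | succ i ih =>
    have : walkSum W (m + (i + 1)) x (fun s => G fun t => s (t + (i + 1)))
        = ∑ y, W x y * walkSum W (m + i) y (fun s => G fun t => s (t + i)) := rfl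
    rw [this]
    simp only [ih, pow_succ', Matrix.mul_apply, Finset.mul_sum, Finset.sum_mul, mul_assoc]
    exact Finset.sum_comm

theorem walkSum_end [DecidableEq X] (W : Matrix X X ℝ) (m : ℕ) (x y : X) :
    walkSum W m x (fun s => if s m = y then 1 else 0) = (W ^ m) x y := by
  have := walkSum_shift W 0 m x (fun s => if s 0 = y then 1 else 0)
  simp only [zero_add] at this
  simp [this, walkSum]

/-- The weight of the closed walks of length `b + d + i` whose nodes at times `i` and `d + i` have
the same label under `π`. By rotation it only depends on the two gaps `d` and `b + i`. -/
theorem sum_walkSum_closed_pair [DecidableEq X] {Y : Type*} [DecidableEq Y] (π : X → Y)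
    {W : Matrix X X ℝ} (hW : ∀ x y, 0 ≤ W x y) (i d b : ℕ) :
    ∑ x, walkSum W (b + d + i) x (fun s => if s (b + d + i) = x then
        (if π (s i) = π (s (d + i)) then 1 else 0) else 0)
      = ∑ z, ∑ w, if π z = π w then (W ^ d) z w * (W ^ (b + i)) w z else 0 := by
  have h1 : ∀ x z : X, walkSum W (b + d) z (fun s => if s (b + d) = x then
        (if π (s 0) = π (s d) then 1 else 0) else 0)
      = ∑ w, (W ^ d) z w * ((if π z = π w then 1 else 0) * (W ^ b) w x) := by
    intro x z
    have e1 := walkSum_congr hW (b + d) z (F := fun s => if s (b + d) = x then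
        (if π (s 0) = π (s d) then 1 else 0) else 0)
        (G := fun s => if s (b + d) = x then (if π z = π (s d) then 1 else 0) else 0)
        (fun s hs => by simp only [hs])
    have e2 := walkSum_shift W b d z
      (fun s => if s b = x then (if π z = π (s 0) then 1 else 0) else 0)
    simp only [zero_add] at e2
    rw [e1, e2]
    refine Finset.sum_congr rfl fun w _ => congrArg _ ?_
    rw [walkSum_congr hW b w (G := fun s => if s b = x then (if π z = π w then 1 else 0) else 0)
      (fun s hs => by simp only [hs])]
    by_cases hzw : π z = π w
    · simp only [hzw, if_true, walkSum_end, one_mul]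
    · simp only [hzw, if_false, ite_self, zero_mul]
      simpa using walkSum_sum W (∅ : Finset ℕ) b w (fun _ _ => 0)
  have h2 : ∀ x : X, walkSum W (b + d + i) x (fun s => if s (b + d + i) = x then
        (if π (s i) = π (s (d + i)) then 1 else 0) else 0)
      = ∑ z, (W ^ i) x z * ∑ w, (W ^ d) z w * ((if π z = π w then 1 else 0) * (W ^ b) w x) := by
    intro x
    have e2 := walkSum_shift W (b + d) i x (fun s => if s (b + d) = x then
        (if π (s 0) = π (s d) then 1 else 0) else 0)
    simp only [zero_add] at e2
    rw [e2]
    simp only [h1]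
  simp only [h2, Finset.mul_sum]
  rw [Finset.sum_comm]
  refine Finset.sum_congr rfl fun z _ => ?_
  rw [Finset.sum_comm]
  refine Finset.sum_congr rfl fun w _ => ?_
  split_ifs with hzw
  · rw [pow_add, Matrix.mul_apply, Finset.mul_sum]
    exact Finset.sum_congr rfl fun x _ => by ring
  · simp

end WalkSum

/-! ### Traces of even powers -/

section Moments

variable {X : Type*} [Fintype X] [DecidableEq X]

/-- The squared Frobenius norm of `W ^ i`. For symmetric `W` it is the trace of `W ^ (2 * i)`, the
weight of the closed walks of length `2 * i`. -/
def evenMoment (W : Matrix X X ℝ) (i : ℕ) : ℝ := ∑ x, ∑ y, (W ^ i) x y ^ 2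

theorem pow_apply_nonneg {W : Matrix X X ℝ} (hW : ∀ x y, 0 ≤ W x y) (m : ℕ) (x y : X) :
    0 ≤ (W ^ m) x y := by
  induction m generalizing x with
  | zero => simp only [pow_zero, Matrix.one_apply]; split_ifs <;> norm_num
  | succ m ih =>
    rw [pow_succ', Matrix.mul_apply]
    exact Finset.sum_nonneg fun z _ => mul_nonneg (hW x z) (ih z)

theorem pow_apply_comm {W : Matrix X X ℝ} (hs : W.IsSymm) (m : ℕ) (x y : X) :
    (W ^ m) x y = (W ^ m) y x := (hs.pow m).apply y x

theorem evenMoment_nonneg (W : Matrix X X ℝ) (i : ℕ) : 0 ≤ evenMoment W i :=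
  Finset.sum_nonneg fun _ _ => Finset.sum_nonneg fun _ _ => sq_nonneg _

theorem evenMoment_zero (W : Matrix X X ℝ) : evenMoment W 0 = Fintype.card X := by
  simp [evenMoment, Matrix.one_apply]

theorem sum_pow_mul_pow {W : Matrix X X ℝ} (hs : W.IsSymm) (a b : ℕ) :
    ∑ x, ∑ y, (W ^ a) x y * (W ^ b) x y = (W ^ (a + b)).trace := by
  simp only [pow_add, Matrix.trace, Matrix.diag, Matrix.mul_apply]
  exact Finset.sum_congr rfl fun x _ => Finset.sum_congr rfl fun y _ => by
    rw [pow_apply_comm hs b]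

theorem evenMoment_eq_trace {W : Matrix X X ℝ} (hs : W.IsSymm) (i : ℕ) :
    evenMoment W i = (W ^ (2 * i)).trace := by
  rw [two_mul, ← sum_pow_mul_pow hs]
  simp only [evenMoment, sq]

theorem evenMoment_logConvex {W : Matrix X X ℝ} (hs : W.IsSymm) (i : ℕ) :
    evenMoment W (i + 1) ^ 2 ≤ evenMoment W i * evenMoment W (i + 2) := by
  have h : evenMoment W (i + 1) = ∑ p : X × X, (W ^ i) p.1 p.2 * (W ^ (i + 2)) p.1 p.2 := by
    rw [evenMoment_eq_trace hs, Fintype.sum_prod_type, sum_pow_mul_pow hs]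
    congr 2; ring
  rw [h]
  refine (Finset.sum_mul_sq_le_sq_mul_sq _ _ _).trans_eq ?_
  simp only [evenMoment, Fintype.sum_prod_type]

/-- By log-convexity the ratios of consecutive even moments increase, so a bound on the last ratio
bounds all of them, and their product starts from `evenMoment W 0`, the number of nodes. -/
theorem evenMoment_le_of_le {W : Matrix X X ℝ} (hs : W.IsSymm) {R : ℝ} (hR : 0 ≤ R) (l : ℕ)
    (h : evenMoment W (l + 1) ≤ R * evenMoment W l) :
    evenMoment W (l + 1) ≤ R ^ (l + 1) * Fintype.card X := by
  induction l with
  | zero => simpa [evenMoment_zero] using h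
  | succ l ih =>
    have h1 : evenMoment W (l + 1) ≤ R * evenMoment W l := by
      rcases (evenMoment_nonneg W (l + 1)).eq_or_lt with h0 | h0
      · rw [← h0]; exact mul_nonneg hR (evenMoment_nonneg W l)
      · refine le_of_mul_le_mul_right ?_ h0
        have := evenMoment_logConvex hs l
        nlinarith [mul_le_mul_of_nonneg_left h (evenMoment_nonneg W l)]
    calc evenMoment W (l + 2) ≤ R * evenMoment W (l + 1) := h
      _ ≤ R * (R ^ (l + 1) * Fintype.card X) := mul_le_mul_of_nonneg_left (ih h1) hR
      _ = _ := by ring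

/-- A lower bound `q` for the Rayleigh quotient of `W` at one vector `h` gives a lower bound for the
even moments, without eigenvalues: the squared norms of `W ^ i h` are log-convex in `i`, and that of
`W ^ l h` is at most `evenMoment W l` times that of `h`. -/
theorem le_evenMoment {W : Matrix X X ℝ} (hs : W.IsSymm) (h : X → ℝ) {q : ℝ} (hq : 0 < q)
    (hpos : 0 < ∑ x, h x ^ 2)
    (hray : q * ∑ x, h x ^ 2 ≤ ∑ x, h x * ∑ y, W x y * h y) (l : ℕ) :
    q ^ (2 * l) ≤ evenMoment W l := by
  set t : ℕ → ℝ := fun i => ∑ x, ((W ^ i).mulVec h x) ^ 2 with ht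
  have t0 : t 0 = ∑ x, h x ^ 2 := by simp [ht]
  have inner (a b c : ℕ) : ∑ x, (W ^ (a + c)).mulVec h x * (W ^ b).mulVec h x
      = ∑ x, (W ^ a).mulVec h x * (W ^ (c + b)).mulVec h x := by
    have e := Matrix.dotProduct_mulVec ((W ^ a).mulVec h) (W ^ c) ((W ^ b).mulVec h)
    rw [← Matrix.mulVec_transpose, (hs.pow c).eq, Matrix.mulVec_mulVec, Matrix.mulVec_mulVec,
      ← pow_add, ← pow_add, add_comm c a] at e
    exact e.symm
  have conv (i : ℕ) : t (i + 1) ^ 2 ≤ t i * t (i + 2) := by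
    have e : t (i + 1) = ∑ x, (W ^ i).mulVec h x * (W ^ (i + 2)).mulVec h x := by
      have := inner i (i + 1) 1
      rw [show 1 + (i + 1) = i + 2 by ring] at this
      simp only [ht, sq, this]
    rw [e]
    exact Finset.sum_mul_sq_le_sq_mul_sq _ _ _
  have step (i : ℕ) : 0 < t i ∧ q ^ 2 * t i ≤ t (i + 1) := by
    induction i with
    | zero =>
      refine ⟨t0 ▸ hpos, ?_⟩
      have e : ∑ x, h x * ∑ y, W x y * h y = ∑ x, h x * (W ^ 1).mulVec h x := by
        simp [Matrix.mulVec, dotProduct]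
      have cs : (∑ x, h x * (W ^ 1).mulVec h x) ^ 2 ≤ t 0 * t 1 := by
        rw [t0]; exact Finset.sum_mul_sq_le_sq_mul_sq _ _ _
      rw [e, ← t0] at hray
      rw [← t0] at hpos
      have := pow_le_pow_left₀ (by positivity) hray 2
      refine le_of_mul_le_mul_right ?_ hpos
      simp only [zero_add]
      nlinarith
    | succ i ih =>
      obtain ⟨h0, h1⟩ := ih
      have h2 : 0 < t (i + 1) := lt_of_lt_of_le (by positivity) h1
      refine ⟨h2, ?_⟩
      have h3 : t i ≤ t (i + 1) / q ^ 2 := by rw [le_div_iff₀ (by positivity)]; linarith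
      have h4 : 0 ≤ t (i + 2) := Finset.sum_nonneg fun _ _ => sq_nonneg _
      have h5 := (conv i).trans (mul_le_mul_of_nonneg_right h3 h4)
      rw [div_mul_eq_mul_div, le_div_iff₀ (by positivity)] at h5
      refine le_of_mul_le_mul_left ?_ h2
      nlinarith
  have lower : q ^ (2 * l) * t 0 ≤ t l := by
    induction l with
    | zero => simp
    | succ l ih =>
      calc q ^ (2 * (l + 1)) * t 0 = q ^ 2 * (q ^ (2 * l) * t 0) := by ring
        _ ≤ q ^ 2 * t l := by gcongr
        _ ≤ _ := (step l).2
  have upper : t l ≤ evenMoment W l * t 0 := by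
    rw [t0, evenMoment, Finset.sum_mul]
    exact Finset.sum_le_sum fun x _ => Finset.sum_mul_sq_le_sq_mul_sq _ _ _
  exact le_of_mul_le_mul_right (lower.trans upper) (t0 ▸ hpos)

end Moments

/-! ### Closed walks with a repeated label -/

section Degenerate

variable {X : Type*} [Fintype X] [DecidableEq X] {Y : Type*} [DecidableEq Y]

/-- The weight of the closed walks of length `d + e` whose nodes at times `0` and `d` have the same
label under `π`. -/
def degenerateWeight (π : X → Y) (W : Matrix X X ℝ) (d e : ℕ) : ℝ :=
  ∑ z, ∑ w, if π z = π w then (W ^ d) z w * (W ^ e) w z else 0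

theorem degenerateWeight_comm (π : X → Y) (W : Matrix X X ℝ) (d e : ℕ) :
    degenerateWeight π W d e = degenerateWeight π W e d := by
  unfold degenerateWeight
  rw [Finset.sum_comm]
  exact Finset.sum_congr rfl fun z _ => Finset.sum_congr rfl fun w _ => by
    simp only [eq_comm (a := π w), mul_comm]

/-- The walk `z, x, …, w, …, y, …, z` is cut into its first step `z x`, a walk of length `a + b` from
`x` through `w` to `y`, and a walk of length `c` from `y` to `z`. Cauchy–Schwarz over the triples
`(z, x, y)` separates the middle walk from the rest. Summed over `z`, the middle walks contribute at
most all walks from `x` to `y`: the label of `w` and the neighbour `x` determine `z` by `hπ`. -/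
theorem sq_degenerateWeight_le {π : X → Y} {W : Matrix X X ℝ} (hW : ∀ x y, 0 ≤ W x y)
    (hs : W.IsSymm) (hπ : ∀ x z z', W z x ≠ 0 → W z' x ≠ 0 → π z = π z' → z = z')
    {η : ℝ} (hη : ∀ z, ∑ x, W z x ^ 2 ≤ η) {a b c : ℕ} (habc : a + b = c + 1) :
    degenerateWeight π W (a + 1) (b + c) ^ 2 ≤ η * evenMoment W c * evenMoment W (c + 1) := by
  set r : X → X → X → ℝ := fun z x y =>
    ∑ w, if π z = π w then (W ^ a) x w * (W ^ b) w y else 0 with hr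
  set q : X → X → X → ℝ := fun z x y => if W z x = 0 then 0 else r z x y with hq
  have term (a b : ℕ) (x w y : X) : 0 ≤ (W ^ a) x w * (W ^ b) w y :=
    mul_nonneg (pow_apply_nonneg hW _ _ _) (pow_apply_nonneg hW _ _ _)
  have r0 (z x y : X) : 0 ≤ r z x y :=
    Finset.sum_nonneg fun w _ => by split_ifs; exacts [term .., le_rfl]
  have q0 (z x y : X) : 0 ≤ q z x y := by
    simp only [hq]; split_ifs; exacts [le_rfl, r0 ..]
  have e : degenerateWeight π W (a + 1) (b + c)
      = ∑ p : X × X × X, (W p.1 p.2.1 * (W ^ c) p.2.2 p.1) * q p.1 p.2.1 p.2.2 := by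
    simp only [Fintype.sum_prod_type, degenerateWeight]
    refine Finset.sum_congr rfl fun z _ => ?_
    have hqr (x y : X) : W z x * (W ^ c) y z * q z x y = W z x * (W ^ c) y z * r z x y := by
      by_cases h : W z x = 0 <;> simp [hq, h]
    simp only [hqr, hr, Finset.mul_sum]
    have : ∀ w, (if π z = π w then (W ^ (a + 1)) z w * (W ^ (b + c)) w z else 0)
        = ∑ x, ∑ y, W z x * (W ^ c) y z
          * (if π z = π w then (W ^ a) x w * (W ^ b) w y else 0) := by
      intro w
      split_ifs
      · rw [pow_succ', pow_add, Matrix.mul_apply, Matrix.mul_apply, Finset.sum_mul_sum]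
        exact Finset.sum_congr rfl fun x _ => Finset.sum_congr rfl fun y _ => by ring
      · simp
    simp only [this]
    rw [Finset.sum_comm]
    exact Finset.sum_congr rfl fun x _ => Finset.sum_comm
  have h1 : ∑ p : X × X × X, (W p.1 p.2.1 * (W ^ c) p.2.2 p.1) ^ 2 ≤ η * evenMoment W c := by
    simp only [Fintype.sum_prod_type, evenMoment, Finset.mul_sum]
    refine Finset.sum_le_sum fun z _ => ?_
    rw [Finset.sum_comm]
    refine Finset.sum_le_sum fun y _ => ?_
    simp only [mul_pow, ← Finset.sum_mul, pow_apply_comm hs c y z]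
    exact mul_le_mul_of_nonneg_right (hη z) (sq_nonneg _)
  have qsum (x y : X) : ∑ z, q z x y ≤ (W ^ (c + 1)) x y := by
    have : ∀ z, q z x y = ∑ w, if W z x ≠ 0 ∧ π z = π w then (W ^ a) x w * (W ^ b) w y else 0 := by
      intro z
      by_cases h : W z x = 0 <;> simp [hq, hr, h]
    simp only [this]
    rw [Finset.sum_comm, ← habc, pow_add, Matrix.mul_apply]
    refine Finset.sum_le_sum fun w _ => ?_
    rw [← Finset.sum_filter, Finset.sum_const, nsmul_eq_mul]
    have hc : (Finset.univ.filter fun z => W z x ≠ 0 ∧ π z = π w).card ≤ 1 := by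
      refine Finset.card_le_one.2 fun z hz z' hz' => ?_
      simp only [Finset.mem_filter, Finset.mem_univ, true_and] at hz hz'
      exact hπ x z z' hz.1 hz'.1 (hz.2.trans hz'.2.symm)
    exact mul_le_of_le_one_left (term ..) (by exact_mod_cast hc)
  have h2 : ∑ p : X × X × X, q p.1 p.2.1 p.2.2 ^ 2 ≤ evenMoment W (c + 1) := by
    simp only [Fintype.sum_prod_type, evenMoment]
    rw [Finset.sum_comm]
    refine Finset.sum_le_sum fun x _ => ?_
    rw [Finset.sum_comm]
    refine Finset.sum_le_sum fun y _ => ?_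
    calc ∑ z, q z x y ^ 2 ≤ (∑ z, q z x y) ^ 2 :=
          Finset.sum_sq_le_sq_sum_of_nonneg fun z _ => q0 z x y
      _ ≤ _ := pow_le_pow_left₀ (Finset.sum_nonneg fun z _ => q0 z x y) (qsum x y) 2
  rw [e]
  -- the left factor carries the step `z x` and the walk from `y` to `z`, the right one the middle walk
  refine (Finset.sum_mul_sq_le_sq_mul_sq _ _ _).trans ?_
  exact mul_le_mul h1 h2 (Finset.sum_nonneg fun _ _ => sq_nonneg _)
    ((Finset.sum_nonneg fun _ _ => sq_nonneg _).trans h1)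

theorem degenerateWeight_le {π : X → Y} {W : Matrix X X ℝ} (hW : ∀ x y, 0 ≤ W x y)
    (hs : W.IsSymm) (hπ : ∀ x z z', W z x ≠ 0 → W z' x ≠ 0 → π z = π z' → z = z')
    {η : ℝ} (hη : ∀ z, ∑ x, W z x ^ 2 ≤ η) {c d e : ℕ} (hd : 0 < d) (he : 0 < e)
    (hde : d + e = 2 * (c + 1)) :
    degenerateWeight π W d e ≤ √(η * evenMoment W c * evenMoment W (c + 1)) := by
  wlog h : d ≤ c + 1 generalizing d e
  · rw [degenerateWeight_comm]
    exact this he hd (by omega) (by omega)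
  obtain ⟨a, rfl⟩ : ∃ a, d = a + 1 := ⟨d - 1, by omega⟩
  obtain ⟨b, rfl⟩ : ∃ b, e = b + c := ⟨e - c, by omega⟩
  exact Real.le_sqrt_of_sq_le (sq_degenerateWeight_le hW hs hπ hη (by omega))

/-- If the weight of the closed walks of length `2 * l` is large compared with the sums of squares of
the rows, some such walk of nonzero weight has pairwise distinct labels. -/
theorem exists_nondegenerate_closed_walk {π : X → Y} {W : Matrix X X ℝ} (hW : ∀ x y, 0 ≤ W x y)
    (hs : W.IsSymm) (hπ : ∀ x z z', W z x ≠ 0 → W z' x ≠ 0 → π z = π z' → z = z')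
    {η : ℝ} (hη0 : 0 ≤ η) (hη : ∀ z, ∑ x, W z x ^ 2 ≤ η) {l : ℕ} (hl : 1 ≤ l)
    (hbig : (16 * (l : ℝ) ^ 4 * η) ^ l * Fintype.card X < evenMoment W l) :
    ∃ s : ℕ → X, s (2 * l) = s 0 ∧ (∀ i < 2 * l, W (s i) (s (i + 1)) ≠ 0) ∧
      ∀ i j, i < j → j < 2 * l → π (s i) ≠ π (s j) := by
  obtain ⟨c, rfl⟩ : ∃ c, l = c + 1 := ⟨l - 1, by omega⟩
  by_contra! hno
  refine hbig.not_ge (evenMoment_le_of_le hs (by positivity) c ?_)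
  set L := 2 * (c + 1) with hL
  -- the pairs of times at which a closed walk may repeat a label
  set P := (Finset.range L ×ˢ Finset.range L).filter fun p => p.1 < p.2 with hP
  set B := √(η * evenMoment W c * evenMoment W (c + 1)) with hB
  have key : evenMoment W (c + 1) ≤ ∑ p ∈ P, B := by
    calc evenMoment W (c + 1) = ∑ x, walkSum W L x fun s => if s L = x then 1 else 0 := by
          rw [evenMoment_eq_trace hs]
          simp only [walkSum_end]
          rfl
      _ ≤ ∑ x, walkSum W L x fun s => ∑ p ∈ P, if s L = x then
            (if π (s p.1) = π (s p.2) then 1 else 0) else 0 := by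
          refine Finset.sum_le_sum fun x _ => walkSum_mono hW L x fun s hs0 hsW => ?_
          split_ifs with hsL
          · obtain ⟨i, j, hij, hj, heq⟩ := hno s (hsL.trans hs0.symm) hsW
            have hmem : (i, j) ∈ P := by
              simp only [hP, Finset.mem_filter, Finset.mem_product, Finset.mem_range]
              omega
            refine le_trans (by simp [heq]) (Finset.single_le_sum (f := fun p : ℕ × ℕ =>
              if π (s p.1) = π (s p.2) then (1 : ℝ) else 0) (fun p _ => ?_) hmem)
            split_ifs <;> norm_num
          · exact (Finset.sum_const_zero).ge
      _ = ∑ p ∈ P, ∑ x, walkSum W L x fun s => if s L = x then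
            (if π (s p.1) = π (s p.2) then 1 else 0) else 0 := by
          simp only [walkSum_sum]
          exact Finset.sum_comm
      _ ≤ ∑ p ∈ P, B := by
          refine Finset.sum_le_sum fun ⟨i, j⟩ hp => ?_
          simp only [hP, Finset.mem_filter, Finset.mem_product, Finset.mem_range] at hp
          obtain ⟨d, rfl⟩ : ∃ d, j = d + i := ⟨j - i, by omega⟩
          obtain ⟨b, hb⟩ : ∃ b, L = b + d + i := ⟨L - (d + i), by omega⟩
          have := sum_walkSum_closed_pair π hW i d b
          rw [← hb] at this
          rw [this]
          exact degenerateWeight_le hW hs hπ hη (by omega) (by omega) (by omega)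
  have hcard : (P.card : ℝ) ≤ 4 * ((c + 1 : ℕ) : ℝ) ^ 2 := by
    have : P.card ≤ L * L := (Finset.card_filter_le _ _).trans (by simp)
    have h2 : L * L = 4 * (c + 1) ^ 2 := by rw [hL]; ring
    exact_mod_cast this.trans_eq h2
  rw [Finset.sum_const, nsmul_eq_mul] at key
  have key2 := key.trans (mul_le_mul_of_nonneg_right hcard (Real.sqrt_nonneg _))
  have m0 := evenMoment_nonneg W c
  have m1 := evenMoment_nonneg W (c + 1)
  -- Squared, `key2` reads `m ^ 2 ≤ 16 * (c + 1) ^ 4 * η * evenMoment W c * m` for the moment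
  -- `m = evenMoment W (c + 1)`, and one factor `m` cancels.
  have hsq := pow_le_pow_left₀ m1 key2 2
  rw [mul_pow, Real.sq_sqrt (by positivity)] at hsq
  rcases m1.eq_or_lt with h0 | h0
  · rw [← h0]; positivity
  · refine le_of_mul_le_mul_right ?_ h0
    calc _ = evenMoment W (c + 1) ^ 2 := by ring
      _ ≤ _ := hsq
      _ = _ := by ring

end Degenerate

/-! ### The graph of vertex-colour pairs -/

section ColourGraph

theorem cycleGraph_adj_succ {m i : ℕ} (hi : i + 1 < m) :
    (SimpleGraph.cycleGraph m).Adj ⟨i, by omega⟩ ⟨i + 1, hi⟩ := by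
  apply SimpleGraph.pathGraph_le_cycleGraph
  simp [SimpleGraph.pathGraph_adj]

theorem cycleGraph_adj_zero_last {m : ℕ} (hm : 1 < m) :
    (SimpleGraph.cycleGraph m).Adj ⟨0, by omega⟩ ⟨m - 1, by omega⟩ := by
  rw [SimpleGraph.cycleGraph_adj']
  left
  rw [Fin.sub_def]
  simp only [show m - (m - 1) + 0 = 1 by omega]
  exact Nat.mod_eq_of_lt hm

variable {V K : Type*} [DecidableEq V] [DecidableEq K]

/-- The adjacency indicator of the graph on pairs `(u, i)` in which every pair of vertices `u ≠ v`
gives one edge, from `(u, c u v)` to `(v, c v u)`. Here `c u v` stands for the colour of the edge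
`uv` in the colouring that belongs to `u`. -/
def colourAdj (c : V → V → K) (x y : V × K) : ℝ :=
  if x.1 ≠ y.1 ∧ c x.1 y.1 = x.2 ∧ c y.1 x.1 = y.2 then 1 else 0

theorem colourAdj_comm (c : V → V → K) (x y : V × K) : colourAdj c x y = colourAdj c y x := by
  simp only [colourAdj, ne_comm (a := x.1), and_comm (a := c x.1 y.1 = x.2)]

theorem colourAdj_nonneg (c : V → V → K) (x y : V × K) : 0 ≤ colourAdj c x y := by
  unfold colourAdj; split_ifs <;> norm_num

variable [Fintype V] [Fintype K]

/-- The degree of a node: the number of vertices `v ≠ x.1` with `c x.1 v = x.2`. -/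
def colourDeg (c : V → V → K) (x : V × K) : ℝ := ∑ y, colourAdj c x y

theorem colourDeg_nonneg (c : V → V → K) (x : V × K) : 0 ≤ colourDeg c x :=
  Finset.sum_nonneg fun _ _ => colourAdj_nonneg c _ _

theorem sum_colourDeg (c : V → V → K) :
    ∑ x, colourDeg c x = Fintype.card V * ((Fintype.card V : ℝ) - 1) := by
  have h (u v : V) : ∑ i, ∑ j, colourAdj c (u, i) (v, j) = if u = v then 0 else 1 := by
    by_cases huv : u = v
    · simp [colourAdj, huv]
    · simp [colourAdj, huv, ite_and]
  have h2 (u : V) : ∑ v, (if u = v then (0 : ℝ) else 1) = (Fintype.card V : ℝ) - 1 := by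
    have : ∀ v, (if u = v then (0 : ℝ) else 1) = 1 - if u = v then 1 else 0 := by
      intro v; split_ifs <;> norm_num
    simp [this, Finset.sum_sub_distrib]
  calc ∑ x, colourDeg c x = ∑ u, ∑ v, ∑ i, ∑ j, colourAdj c (u, i) (v, j) := by
        simp only [colourDeg, Fintype.sum_prod_type]
        exact Finset.sum_congr rfl fun u _ => Finset.sum_comm
    _ = _ := by simp only [h, h2, Finset.sum_const, Finset.card_univ, nsmul_eq_mul]

/-- The factor `1 / √(deg x)` of the normalised adjacency matrix, replaced by `0` at nodes of degree
less than `δ`. -/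
noncomputable def colourScale (c : V → V → K) (δ : ℝ) (x : V × K) : ℝ :=
  if δ ≤ colourDeg c x then 1 / √(colourDeg c x) else 0

/-- The normalised adjacency matrix restricted to the nodes of degree at least `δ`. The degrees are
those in the whole graph. -/
noncomputable def colourMatrix (c : V → V → K) (δ : ℝ) : Matrix (V × K) (V × K) ℝ :=
  fun x y => colourAdj c x y * (colourScale c δ x * colourScale c δ y)

theorem colourScale_nonneg (c : V → V → K) (δ : ℝ) (x : V × K) : 0 ≤ colourScale c δ x := by
  unfold colourScale; split_ifs <;> positivity

theorem colourMatrix_nonneg (c : V → V → K) (δ : ℝ) (x y : V × K) : 0 ≤ colourMatrix c δ x y :=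
  mul_nonneg (colourAdj_nonneg ..) (mul_nonneg (colourScale_nonneg ..) (colourScale_nonneg ..))

theorem colourMatrix_isSymm (c : V → V → K) (δ : ℝ) : (colourMatrix c δ).IsSymm := by
  ext x y
  simp only [Matrix.transpose_apply, colourMatrix, colourAdj_comm c y x, mul_comm]

theorem adj_of_colourMatrix_ne_zero {c : V → V → K} {δ : ℝ} {x y : V × K}
    (h : colourMatrix c δ x y ≠ 0) : x.1 ≠ y.1 ∧ c x.1 y.1 = x.2 ∧ c y.1 x.1 = y.2 := by
  by_contra hn
  exact h (by simp [colourMatrix, colourAdj, hn])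

theorem sq_colourScale_le (c : V → V → K) {δ : ℝ} (hδ : 0 < δ) (x : V × K) :
    colourScale c δ x ^ 2 ≤ 1 / δ := by
  unfold colourScale
  split_ifs with h
  · rw [div_pow, Real.sq_sqrt (hδ.le.trans h), one_pow]
    exact one_div_le_one_div_of_le hδ h
  · rw [zero_pow two_ne_zero]; positivity

theorem colourMatrix_row_sq_sum_le (c : V → V → K) {δ : ℝ} (hδ : 0 < δ) (x : V × K) :
    ∑ y, colourMatrix c δ x y ^ 2 ≤ 1 / δ := by
  have h1 : ∀ y, colourMatrix c δ x y ^ 2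
      ≤ colourAdj c x y * (colourScale c δ x ^ 2 * (1 / δ)) := by
    intro y
    have : colourAdj c x y ^ 2 = colourAdj c x y := by
      unfold colourAdj; split_ifs <;> norm_num
    rw [colourMatrix, mul_pow, mul_pow, this]
    exact mul_le_mul_of_nonneg_left (mul_le_mul_of_nonneg_left (sq_colourScale_le c hδ y)
      (sq_nonneg _)) (colourAdj_nonneg ..)
  refine (Finset.sum_le_sum fun y _ => h1 y).trans ?_
  rw [← Finset.sum_mul, ← mul_assoc]
  refine mul_le_of_le_one_left (by positivity) ?_
  change colourDeg c x * colourScale c δ x ^ 2 ≤ 1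
  unfold colourScale
  split_ifs with h
  · rw [div_pow, Real.sq_sqrt (hδ.le.trans h), one_pow, mul_one_div_cancel (hδ.trans_le h).ne']
  · norm_num

/-- The quadratic form at `x ↦ √(deg x)` counts the ordered edges between nodes of degree at least
`δ`. At most `|V| * |K| * δ` ordered edges start, and as many end, at a node of smaller degree. -/
theorem le_rayleigh_colourMatrix (c : V → V → K) {δ : ℝ} (hδ : 0 < δ) :
    ∑ x, colourDeg c x - 2 * (Fintype.card V * Fintype.card K * δ)
      ≤ ∑ x, √(colourDeg c x) * ∑ y, colourMatrix c δ x y * √(colourDeg c y) := by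
  -- the indicator of the nodes of small degree
  set b : V × K → ℝ := fun x => if δ ≤ colourDeg c x then 0 else 1 with hb
  have hscale (x : V × K) : √(colourDeg c x) * colourScale c δ x = 1 - b x := by
    simp only [hb, colourScale]
    split_ifs with h
    · rw [mul_one_div_cancel (Real.sqrt_pos.2 (hδ.trans_le h)).ne', sub_zero]
    · simp
  have hb0 (x : V × K) : 0 ≤ b x := by simp only [hb]; split_ifs <;> norm_num
  have hbad : ∑ x, b x * colourDeg c x ≤ Fintype.card V * Fintype.card K * δ := by
    calc ∑ x, b x * colourDeg c x ≤ ∑ _x : V × K, δ := by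
          refine Finset.sum_le_sum fun x _ => ?_
          simp only [hb]
          split_ifs with h
          · simpa using hδ.le
          · simpa using (not_le.1 h).le
      _ = _ := by simp
  have e1 : ∑ x, √(colourDeg c x) * ∑ y, colourMatrix c δ x y * √(colourDeg c y)
      = ∑ x, ∑ y, colourAdj c x y * ((1 - b x) * (1 - b y)) := by
    refine Finset.sum_congr rfl fun x _ => ?_
    rw [Finset.mul_sum]
    refine Finset.sum_congr rfl fun y _ => ?_
    rw [← hscale, ← hscale, colourMatrix]
    ring
  have e2 : ∑ x, ∑ y, (colourAdj c x y - b x * colourAdj c x y - b y * colourAdj c y x)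
      = ∑ x, colourDeg c x - 2 * ∑ x, b x * colourDeg c x := by
    simp only [Finset.sum_sub_distrib]
    rw [Finset.sum_comm (f := fun x y => b y * colourAdj c y x)]
    simp only [← Finset.mul_sum, colourDeg]
    ring
  calc _ ≤ ∑ x, colourDeg c x - 2 * ∑ x, b x * colourDeg c x := by linarith
    _ = _ := e2.symm
    _ ≤ _ := by
      rw [e1]
      refine Finset.sum_le_sum fun x _ => Finset.sum_le_sum fun y _ => ?_
      rw [colourAdj_comm c y x]
      nlinarith [mul_nonneg (colourAdj_nonneg c x y) (mul_nonneg (hb0 x) (hb0 y))]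

/-- With few colours there is a cycle of length `2 * l` in which each vertex `w i` sees the edges to
its two neighbours on the cycle in the same colour. -/
theorem exists_cycle_of_colouring (c : V → V → K) {l : ℕ} (hl : 2 ≤ l)
    (hV : 2 ≤ Fintype.card V)
    (hbig : (512 * (l : ℝ) ^ 4) ^ l * (Fintype.card K : ℝ) ^ (l + 1)
      < (Fintype.card V : ℝ) ^ (l - 1)) :
    ∃ w : Fin (2 * l) ↪ V, ∀ i, ∃ a b, a ≠ b ∧ (SimpleGraph.cycleGraph (2 * l)).Adj i a ∧
      (SimpleGraph.cycleGraph (2 * l)).Adj i b ∧ c (w i) (w a) = c (w i) (w b) := by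
  set n : ℝ := (Fintype.card V : ℝ) with hn
  set k : ℝ := (Fintype.card K : ℝ) with hk
  have hn2 : 2 ≤ n := by rw [hn]; exact_mod_cast hV
  have hk1 : 0 < k := by
    obtain ⟨v⟩ : Nonempty V := Fintype.card_pos_iff.1 (by omega)
    rw [hk]; exact_mod_cast Fintype.card_pos_iff.2 ⟨c v v⟩
  -- With this threshold, nodes of small degree meet at most half of the `n * (n - 1)` ordered edges.
  set δ : ℝ := (n - 1) / (4 * k) with hδdef
  have hδ : 0 < δ := div_pos (by linarith) (by linarith)
  have hsq : ∑ x, √(colourDeg c x) ^ 2 = n * (n - 1) := by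
    rw [← sum_colourDeg c]
    exact Finset.sum_congr rfl fun x _ => Real.sq_sqrt (colourDeg_nonneg c x)
  have hlow : (1 / 2 : ℝ) ^ (2 * l) ≤ evenMoment (colourMatrix c δ) l := by
    refine le_evenMoment (colourMatrix_isSymm c δ) (fun x => √(colourDeg c x)) (by norm_num)
      (by rw [hsq]; nlinarith) ?_ l
    refine le_trans (le_of_eq ?_) (le_rayleigh_colourMatrix c hδ)
    rw [hsq, sum_colourDeg, hδdef]
    field_simp
    ring
  obtain ⟨s, hclosed, hadj, hdist⟩ := exists_nondegenerate_closed_walk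
    (π := Prod.fst) (colourMatrix_nonneg c δ) (colourMatrix_isSymm c δ)
    (fun x z z' h h' hz => Prod.ext hz (by
      rw [← (adj_of_colourMatrix_ne_zero h).2.1, ← (adj_of_colourMatrix_ne_zero h').2.1, hz]))
    (η := 1 / δ) (by positivity) (colourMatrix_row_sq_sum_le c hδ) (l := l) (by omega) (by
      refine lt_of_lt_of_le ?_ hlow
      rw [Fintype.card_prod, Nat.cast_mul, ← hn, ← hk, pow_mul, hδdef]
      have hm : 0 < n - 1 := by linarith
      have e : 16 * (l : ℝ) ^ 4 * (1 / ((n - 1) / (4 * k))) = 64 * (l : ℝ) ^ 4 * k / (n - 1) := by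
        field_simp; ring
      rw [e, div_pow, div_mul_eq_mul_div, div_lt_iff₀ (by positivity)]
      have hpow : (n / 2) ^ l ≤ (n - 1) ^ l := pow_le_pow_left₀ (by positivity) (by linarith) l
      have h4 : (512 * (l : ℝ) ^ 4) ^ l = (8 : ℝ) ^ l * (64 * (l : ℝ) ^ 4) ^ l := by
        rw [← mul_pow]; congr 1; ring
      have hnl : n ^ l = n ^ (l - 1) * n := by rw [← pow_succ]; congr 1; omega
      have main : (64 * (l : ℝ) ^ 4) ^ l * k ^ (l + 1) * n * 8 ^ l < n ^ l := by
        rw [hnl]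
        calc _ = (512 * (l : ℝ) ^ 4) ^ l * k ^ (l + 1) * n := by rw [h4]; ring
          _ < _ := mul_lt_mul_of_pos_right hbig (by linarith)
      -- the constants: `(1 / 4) * (1 / 2) * 8 = 1`, and `8 * 64 = 512`
      have e8 : (((1 : ℝ) / 2) ^ 2) ^ l * (n / 2) ^ l * 8 ^ l = n ^ l := by
        rw [← mul_pow, ← mul_pow]; congr 1; ring
      refine lt_of_lt_of_le ?_ (mul_le_mul_of_nonneg_left hpow (by positivity))
      refine lt_of_mul_lt_mul_right ?_ (by positivity : (0 : ℝ) ≤ 8 ^ l)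
      rw [e8]
      refine lt_of_eq_of_lt ?_ main
      rw [mul_pow]; ring)
  have hinj : Function.Injective fun i : Fin (2 * l) => (s i).1 := by
    intro i j hij
    rcases lt_trichotomy i j with h | h | h
    · exact absurd hij (hdist i j h j.2)
    · exact h
    · exact absurd hij.symm (hdist j i h i.2)
  have hstep (i : ℕ) (hi : i + 1 < 2 * l) :
      c (s (i + 1)).1 (s i).1 = c (s (i + 1)).1 (s (i + 2)).1 :=
    (adj_of_colourMatrix_ne_zero (hadj i (by omega))).2.2.trans
      (adj_of_colourMatrix_ne_zero (hadj (i + 1) (by omega))).2.1.symm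
  have hwrap : c (s 0).1 (s (2 * l - 1)).1 = c (s 0).1 (s 1).1 := by
    have h1 := (adj_of_colourMatrix_ne_zero (hadj (2 * l - 1) (by omega))).2.2
    rw [show 2 * l - 1 + 1 = 2 * l by omega, hclosed] at h1
    exact h1.trans (adj_of_colourMatrix_ne_zero (hadj 0 (by omega))).2.1.symm
  refine ⟨⟨_, hinj⟩, ?_⟩
  rintro ⟨_ | i, hi⟩
  · refine ⟨⟨2 * l - 1, by omega⟩, ⟨1, by omega⟩, by simp; omega,
      cycleGraph_adj_zero_last (by omega), cycleGraph_adj_succ (by omega), hwrap⟩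
  · by_cases hlast : i + 2 < 2 * l
    · exact ⟨⟨i, by omega⟩, ⟨i + 2, hlast⟩, by simp, (cycleGraph_adj_succ hi).symm,
        cycleGraph_adj_succ hlast, hstep i hi⟩
    · obtain rfl : i = 2 * l - 2 := by omega
      refine ⟨⟨2 * l - 2, by omega⟩, ⟨0, by omega⟩, by simp; omega,
        (cycleGraph_adj_succ hi).symm, ?_, ?_⟩
      · have := (cycleGraph_adj_zero_last (m := 2 * l) (by omega)).symm
        simpa only [show 2 * l - 2 + 1 = 2 * l - 1 by omega] using this
      · have := hstep _ hi
        rw [show 2 * l - 2 + 2 = 2 * l by omega, hclosed] at this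
        exact this

end ColourGraph

/-! ### Lower bounds for local colourings -/

section Local

/-- A copy of `H` in which every vertex sees two of its own edges in the same colour refutes locality. -/
theorem not_isLocalColouring_of_embedding {m : ℕ} {H : SimpleGraph (Fin m)} {n : ℕ} {K : Type*}
    {f : Fin n → (SimpleGraph.completeGraph (Fin n)).edgeSet → K} (w : Fin m ↪ Fin n)
    (h : ∀ i, ∃ a b, a ≠ b ∧ H.Adj i a ∧ H.Adj i b ∧
      ∀ e e' : (SimpleGraph.completeGraph (Fin n)).edgeSet, (e : Sym2 (Fin n)) = s(w i, w a) →
        (e' : Sym2 (Fin n)) = s(w i, w b) → f (w i) e = f (w i) e') :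
    ¬ IsLocalColouring H f := by
  intro hf
  let φ : H.Copy (SimpleGraph.completeGraph (Fin n)) :=
    ⟨⟨w, fun hab => w.injective.ne hab.ne⟩, w.injective⟩
  obtain ⟨u, hu, hinj⟩ := hf φ.toSubgraph ⟨φ.isoToSubgraph⟩
  obtain ⟨i, -, rfl⟩ := hu
  obtain ⟨a, b, hab, hia, hib, hfe⟩ := h i
  have hmem {x : Fin m} (hx : H.Adj i x) : s(w i, w x) ∈ φ.toSubgraph.edgeSet :=
    ⟨i, x, hx, rfl, rfl⟩
  have heq := hinj (x₁ := ⟨s(w i, w a), SimpleGraph.Subgraph.edgeSet_subset _ (hmem hia)⟩)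
    (x₂ := ⟨s(w i, w b), SimpleGraph.Subgraph.edgeSet_subset _ (hmem hib)⟩)
    (hmem hia) (hmem hib) (hfe _ _ rfl rfl)
  exact hab (w.injective (Sym2.congr_right.1 (Subtype.ext_iff.1 heq)))

theorem pow_le_of_isLocalColouring {l : ℕ} (hl : 2 ≤ l) {H : SimpleGraph (Fin (2 * l))}
    (hH : SimpleGraph.cycleGraph (2 * l) ≤ H) {n k : ℕ} (hn : 2 ≤ n)
    {f : Fin n → (SimpleGraph.completeGraph (Fin n)).edgeSet → Fin k}
    (hf : IsLocalColouring H f) :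
    (n : ℝ) ^ (l - 1) ≤ (512 * (l : ℝ) ^ 4) ^ l * (k : ℝ) ^ (l + 1) := by
  by_contra! hlt
  have hmem {u v : Fin n} (huv : u ≠ v) : s(u, v) ∈ (SimpleGraph.completeGraph (Fin n)).edgeSet :=
    huv
  have hne : (⟨0, by omega⟩ : Fin n) ≠ ⟨1, by omega⟩ := by simp
  -- the value at `u = v` is arbitrary, that of some fixed edge
  let c : Fin n → Fin n → Fin k := fun u v =>
    if huv : u ≠ v then f u ⟨s(u, v), hmem huv⟩ else f u ⟨_, hmem hne⟩
  have hc {u v : Fin n} (huv : u ≠ v) {e : (SimpleGraph.completeGraph (Fin n)).edgeSet}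
      (he : (e : Sym2 (Fin n)) = s(u, v)) : f u e = c u v := by
    simp only [c, dif_pos huv]
    exact congrArg _ (Subtype.ext he)
  obtain ⟨w, hw⟩ := exists_cycle_of_colouring c hl (by simpa using hn) (by simpa using hlt)
  refine not_isLocalColouring_of_embedding w (fun i => ?_) hf
  obtain ⟨a, b, hab, hia, hib, hcol⟩ := hw i
  refine ⟨a, b, hab, hH hia, hH hib, fun e e' he he' => ?_⟩
  rw [hc (w.injective.ne hia.ne) he, hc (w.injective.ne hib.ne) he', hcol]

theorem le_localColourNumber {l : ℕ} (hl : 2 ≤ l) {H : SimpleGraph (Fin (2 * l))}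
    (hH : SimpleGraph.cycleGraph (2 * l) ≤ H) {n : ℕ} (hn : 2 ≤ n) :
    1 / (512 * (l : ℝ) ^ 4) ^ l * (n : ℝ) ^ (1 - 2 / ((l : ℝ) + 1)) ≤ localColourNumber n H := by
  have : Nonempty (Fin (2 * l)) := ⟨⟨0, by omega⟩⟩
  obtain ⟨f, hf⟩ := (localColourNumber_isLeast n H).1
  have h := pow_le_of_isLocalColouring hl hH hn hf
  set k := localColourNumber n H
  set C : ℝ := (512 * (l : ℝ) ^ 4) ^ l with hC
  have hl1 : (1 : ℝ) ≤ l := by exact_mod_cast (by omega : 1 ≤ l)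
  have hC1 : 1 ≤ C := one_le_pow₀ (by nlinarith [one_le_pow₀ hl1 (n := 4)])
  refine le_of_pow_le_pow_left₀ (Nat.succ_ne_zero l) (Nat.cast_nonneg k) ?_
  have e : ((n : ℝ) ^ (1 - 2 / ((l : ℝ) + 1))) ^ (l + 1) = (n : ℝ) ^ (l - 1) := by
    rw [← Real.rpow_natCast, ← Real.rpow_mul (Nat.cast_nonneg n), ← Real.rpow_natCast]
    congr 1
    rw [Nat.cast_sub (by omega : 1 ≤ l)]
    push_cast
    field_simp
    ring
  calc (1 / C * (n : ℝ) ^ (1 - 2 / ((l : ℝ) + 1))) ^ (l + 1)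
      = (1 / C) ^ (l + 1) * (n : ℝ) ^ (l - 1) := by rw [mul_pow, e]
    _ ≤ (1 / C) ^ 1 * (C * (k : ℝ) ^ (l + 1)) := by
        refine mul_le_mul ?_ h (by positivity) (by positivity)
        exact pow_le_pow_of_le_one (by positivity) (div_le_one_of_le₀ hC1 (by positivity)) (by omega)
    _ = (k : ℝ) ^ (l + 1) := by field_simp

end Local

theorem theorem1p6 :
    (∀ ℓ : ℕ, 2 ≤ ℓ → ∃ c : ℝ, 0 < c ∧ ∀ᶠ n : ℕ in Filter.atTop,
      c * (n : ℝ) ^ (1 - 2 / ((ℓ : ℝ) + 1)) ≤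
        (localColourNumber n (SimpleGraph.cycleGraph (2 * ℓ)) : ℝ)) ∧
    (∀ r : ℕ, 4 ≤ r → Even r → ∃ c : ℝ, 0 < c ∧ ∀ᶠ n : ℕ in Filter.atTop,
      c * (n : ℝ) ^ (1 - 4 / ((r : ℝ) + 2)) ≤
        (localColourNumber n (SimpleGraph.completeGraph (Fin r)) : ℝ)) ∧
    (∀ ε : ℝ, 0 < ε → ∃ r : ℕ, ∀ᶠ n : ℕ in Filter.atTop,
      (n : ℝ) ^ (1 - ε) ≤ (localColourNumber n (SimpleGraph.completeGraph (Fin r)) : ℝ)) := by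
  refine ⟨fun l hl => ?_, fun r hr hr2 => ?_, fun ε hε => ?_⟩
  · exact ⟨1 / (512 * (l : ℝ) ^ 4) ^ l, by positivity,
      Filter.eventually_atTop.2 ⟨2, fun n hn => le_localColourNumber hl le_rfl hn⟩⟩
  · obtain ⟨l, rfl⟩ := hr2.exists_two_nsmul
    rw [smul_eq_mul] at hr ⊢
    refine ⟨1 / (512 * (l : ℝ) ^ 4) ^ l, by have : 0 < l := by omega
                                            positivity,
      Filter.eventually_atTop.2 ⟨2, fun n hn => ?_⟩⟩
    have e : 4 / (((2 * l : ℕ) : ℝ) + 2) = 2 / ((l : ℝ) + 1) := by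
      push_cast; field_simp; ring
    rw [e]
    exact le_localColourNumber (by omega) le_top hn
  · obtain ⟨l, hl⟩ := exists_nat_gt (max 2 (2 / ε))
    -- `2 / (l + 1) < ε` leaves a positive power of `n` to absorb the constant
    have hl2 : 2 < (l : ℝ) := (le_max_left _ _).trans_lt hl
    have hlε : 2 / ε < (l : ℝ) := (le_max_right _ _).trans_lt hl
    have hl2' : 2 < l := by exact_mod_cast hl2
    refine ⟨2 * l, ?_⟩
    have hgap : 0 < ε - 2 / ((l : ℝ) + 1) := by
      rw [sub_pos, div_lt_iff₀ (by positivity)]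
      rw [div_lt_iff₀ hε] at hlε
      nlinarith
    have hlim := ((tendsto_rpow_atTop hgap).comp tendsto_natCast_atTop_atTop).eventually_ge_atTop
      ((512 * (l : ℝ) ^ 4) ^ l)
    filter_upwards [hlim, Filter.eventually_ge_atTop 2] with n hn hn2
    refine le_trans ?_ (le_localColourNumber hl2'.le (H := SimpleGraph.completeGraph _) le_top hn2)
    have hn0 : (0 : ℝ) < n := by exact_mod_cast (by omega : 0 < n)
    rw [one_div, inv_mul_eq_div, le_div_iff₀ (by positivity)]
    calc (n : ℝ) ^ (1 - ε) * (512 * (l : ℝ) ^ 4) ^ l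
        ≤ (n : ℝ) ^ (1 - ε) * (n : ℝ) ^ (ε - 2 / ((l : ℝ) + 1)) := by gcongr; exact hn
      _ = _ := by rw [← Real.rpow_add hn0]; congr 1; ring
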